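/- Let $d\in\{2,3\}$, let $\Omega\subset\mathbb R^d$ be a bounded domain (nonempty, open, connected) with boundary $\Gamma=\partial\Omega$, and let $k\ge 1$ be an integer. Let $\mathcal T_h$ be a finite partition of $\overline\Omega$ into closed polygons ($d=2$) or polyhedra ($d=3$), not necessarily convex, with nonempty connected interiors that are pairwise disjoint. Let $\mathcal E_h$ be its finite set of edges ($d=2$) or flat polygonal faces ($d=3$): the boundary of every $T\in\mathcal T_h$ is the union of the $e\in\mathcal E_h$ contained in it, every $e\in\mathcal E_h$ is contained in $\partial T$ for some $T\in\mathcal T_h$, and different members of $\mathcal E_h$ have disjoint relative interiors. Let $h_T$ be the diameter of $T$. Let $\mathsf{RM}$ be the space of rigid motions $x\mapsto a+\eta x$ with $a\in\mathbb R^d$ and $\eta$ a skew-symmetric $d\times d$ matrix, and for $e\in\mathcal E_h$ let $V_{k-1}(e)=[P_{k-1}(e)]^d+\mathsf{RM}|_e\subset[L^2(e)]^d$. Let $Q_b$ be the $L^2(e)$-orthogonal projection onto $V_{k-1}(e)$ on each $e\in\mathcal E_h$. Let $V_h$ be the linear space of the pairs $v=\{v_0,v_b\}$, where $v_0$ has a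 component $v_0|_T\in[P_k(T)]^d$ for every $T\in\mathcal T_h$ (with no continuity between elements), and $v_b$ has a single component $v_b|_e\in V_{k-1}(e)$ for every $e\in\mathcal E_h$. Let $V_h^0$ be the subspace of those $v\in V_h$ with $v_b=0$ on every $e\in\mathcal E_h$ contained in $\Gamma$. With $\varepsilon(v_0)=\frac12(\nabla v_0+\nabla v_0^T)$, put $$|||v|||=\Big(\sum_{T\in\mathcal T_h}\Big(\|\varepsilon(v_0)\|_{L^2(T)}^2+h_T^{-1}\sum_{e\in\mathcal E_h,\ e\subset\partial T}\|Q_b (v_0|_T)-v_b\|_{L^2(e)}^2\Big)\Big)^{1/2},\qquad v\in V_h .$$ Then $|||\cdot|||$ is a seminorm on $V_h$ (nonnegative, absolutely homogeneous, and satisfying the triangle inequality), and it is a norm on $V_h^0$: for $v\in V_h^0$ one has $|||v|||=0$ if and only if $v=0$. -/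

import Mathlib

noncomputable section

namespace WG

open MeasureTheory

/-- The Euclidean space `ℝ^d`. -/
abbrev E (d : ℕ) : Type := EuclideanSpace ℝ (Fin d)

/-- `S ⊆ ℝ^d` is an `n`-dimensional polytope, closed and not necessarily convex: a finite union of
`n`-dimensional convex polytopes which spans an `n`-dimensional affine subspace and whose interior
relative to that subspace is nonempty and connected.  For `n = 1, 2, 3` these are the segments, the
flat polygons and the polyhedra. -/
structure IsPolytope {d : ℕ} (n : ℕ) (S : Set (E d)) : Prop where
  finrank_vectorSpan : Module.finrank ℝ (vectorSpan ℝ S) = n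
  exists_pieces : ∃ F : Finset (Finset (E d)),
    (∀ P ∈ F, Module.finrank ℝ (vectorSpan ℝ (P : Set (E d))) = n) ∧
      S = ⋃ P ∈ F, convexHull ℝ (P : Set (E d))
  isConnected_interior : IsConnected (intrinsicInterior ℝ S)

/-- A finite partition of `Ω` into polygons (`d = 2`) or polyhedra (`d = 3`), with its set of edges
(`d = 2`) or flat faces (`d = 3`).  The word face is used for both. -/
structure Partition {d : ℕ} (Ω : Set (E d)) where
  /-- the elements `T`, as closed sets -/
  cells : Finset (Set (E d))
  /-- the edges or faces `e`, as closed sets -/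
  faces : Finset (Set (E d))
  isPolytope_cell : ∀ T ∈ cells, IsPolytope d T
  isPolytope_face : ∀ e ∈ faces, IsPolytope (d - 1) e
  iUnion_cells : ⋃ T ∈ cells, T = closure Ω
  disjoint_cells : ∀ T ∈ cells, ∀ T' ∈ cells, T ≠ T' → Disjoint (interior T) (interior T')
  /-- the boundary of an element is made up of the faces that it contains -/
  frontier_cell : ∀ T ∈ cells, frontier T = ⋃ e ∈ faces, ⋃ _ : e ⊆ frontier T, e
  /-- every face is a face of an element -/
  exists_cell : ∀ e ∈ faces, ∃ T ∈ cells, e ⊆ frontier T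
  /-- different faces do not overlap -/
  disjoint_faces : ∀ e ∈ faces, ∀ e' ∈ faces, e ≠ e' →
    Disjoint (intrinsicInterior ℝ e) (intrinsicInterior ℝ e')

/-- The vector fields on `ℝ^d` whose components are polynomials of total degree at most `r`.
For a set `T` with nonempty interior this is `[P_r(T)]^d`: a polynomial on `T` is identified with
the polynomial function on `ℝ^d` of which it is the restriction. -/
def polyField (d r : ℕ) : Submodule ℝ C(E d, E d) where
  carrier := {v | ∃ p : Fin d → MvPolynomial (Fin d) ℝ, (∀ i, (p i).totalDegree ≤ r) ∧
    ∀ x i, v x i = MvPolynomial.eval (fun j => x j) (p i)}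
  add_mem' := by
    rintro v w ⟨p, hp, hv⟩ ⟨q, hq, hw⟩
    exact ⟨p + q, fun i => (MvPolynomial.totalDegree_add _ _).trans (max_le (hp i) (hq i)),
      fun x i => by simp [hv, hw]⟩
  zero_mem' := ⟨0, fun i => by simp, fun x i => by simp⟩
  smul_mem' := by
    rintro c v ⟨p, hp, hv⟩
    exact ⟨c • p, fun i => (MvPolynomial.totalDegree_smul_le _ _).trans (hp i),
      fun x i => by simp [hv, MvPolynomial.smul_eval]⟩

/-- The rigid motions `x ↦ a + η x` with `η` a skew-symmetric matrix. -/
def rigidMotion (d : ℕ) : Submodule ℝ C(E d, E d) where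
  carrier := {v | ∃ (a : E d) (η : Matrix (Fin d) (Fin d) ℝ), η.transpose = -η ∧
    ∀ x, v x = a + Matrix.toEuclideanLin η x}
  add_mem' := by
    rintro v w ⟨a, η, hη, hv⟩ ⟨b, ξ, hξ, hw⟩
    refine ⟨a + b, η + ξ, ?_, fun x => ?_⟩
    · rw [Matrix.transpose_add, hη, hξ, neg_add]
    · rw [ContinuousMap.add_apply, hv, hw, map_add, LinearMap.add_apply]
      abel
  zero_mem' := ⟨0, 0, by simp, fun x => by simp⟩
  smul_mem' := by
    rintro c v ⟨a, η, hη, hv⟩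
    refine ⟨c • a, c • η, ?_, fun x => ?_⟩
    · rw [Matrix.transpose_smul, hη, smul_neg]
    · rw [ContinuousMap.smul_apply, hv, map_smul, LinearMap.smul_apply, smul_add]

/-- The length (`d = 2`) or area (`d = 3`) measure on `e`. -/
abbrev faceMeasure {d : ℕ} (e : Set (E d)) : Measure (E d) :=
  (Measure.euclideanHausdorffMeasure (d - 1)).restrict e

/-- `[L²(e)]^d`. -/
abbrev FaceL2 {d : ℕ} (e : Set (E d)) : Type := Lp (E d) 2 (faceMeasure e)

theorem IsPolytope.isCompact {d n : ℕ} {S : Set (E d)} (h : IsPolytope n S) : IsCompact S := by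
  obtain ⟨F, -, rfl⟩ := h.exists_pieces
  exact F.isCompact_biUnion fun P _ => P.finite_toSet.isCompact_convexHull (𝕜 := ℝ)

theorem IsPolytope.measure_lt_top {d n : ℕ} {S : Set (E d)} (h : IsPolytope n S) :
    Measure.euclideanHausdorffMeasure n S < ⊤ := by
  classical
  have hne : S.Nonempty := h.isConnected_interior.nonempty.mono (intrinsicInterior_subset (𝕜 := ℝ))
  obtain ⟨x, hx⟩ := hne
  have hxA : x ∈ affineSpan ℝ S := subset_affineSpan ℝ S hx
  have : Nonempty (affineSpan ℝ S) := ⟨⟨x, hxA⟩⟩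
  set s : Set (affineSpan ℝ S) := (↑) ⁻¹' S with hs
  have hS : ((↑) : affineSpan ℝ S → E d) '' s = S := by
    refine Set.image_preimage_eq_of_subset ?_
    rw [Subtype.range_coe_subtype]
    exact subset_affineSpan ℝ S
  rw [← hS, AffineSubspace.euclideanHausdorffMeasure_coe_image]
  have hn : n = Module.finrank ℝ (affineSpan ℝ S).direction := by
    rw [direction_affineSpan, h.finrank_vectorSpan]
  rw [hn, EuclideanGeometry.euclideanHausdorffMeasure_eq (⟨x, hxA⟩ : affineSpan ℝ S)]
  have hclosed : IsClosed ((affineSpan ℝ S : AffineSubspace ℝ (E d)) : Set (E d)) :=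
    AffineSubspace.closed_of_finiteDimensional _
  have hsc : IsCompact s :=
    hclosed.isClosedEmbedding_subtypeVal.isCompact_preimage h.isCompact
  rw [Measure.map_apply (IsometryEquiv.vaddConst _).continuous.measurable hsc.measurableSet]
  exact ((IsometryEquiv.vaddConst (⟨x, hxA⟩ : affineSpan ℝ S)).toHomeomorph.isCompact_preimage.2
    hsc).measure_lt_top

theorem IsPolytope.memLp {d : ℕ} {e : Set (E d)} (h : IsPolytope (d - 1) e) (v : C(E d, E d)) :
    MemLp v 2 (faceMeasure e) := by
  have : IsFiniteMeasure (faceMeasure e) := ⟨by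
    rw [Measure.restrict_apply_univ]; exact h.measure_lt_top⟩
  obtain ⟨C, hC⟩ := h.isCompact.exists_bound_of_continuousOn v.continuous.continuousOn
  exact MemLp.of_bound v.continuous.aestronglyMeasurable C
    ((ae_restrict_iff' h.isCompact.measurableSet).2 (Filter.Eventually.of_forall hC))

/-- The trace `v ↦ v|_e` on a face, with values in `[L²(e)]^d`. -/
def trace {d : ℕ} {e : Set (E d)} (h : IsPolytope (d - 1) e) : C(E d, E d) →ₗ[ℝ] FaceL2 e where
  toFun v := (h.memLp v).toLp v
  map_add' v w := MemLp.toLp_add (h.memLp v) (h.memLp w)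
  map_smul' c v := MemLp.toLp_const_smul c (h.memLp v)

/-- `V_{k-1}(e) = [P_{k-1}(e)]^d + P_RM(e)`, as a subspace of `[L²(e)]^d`. -/
def faceSpace {d : ℕ} (k : ℕ) {e : Set (E d)} (h : IsPolytope (d - 1) e) :
    Submodule ℝ (FaceL2 e) :=
  (polyField d (k - 1)).map (trace h) ⊔ (rigidMotion d).map (trace h)

theorem rigidMotion_le (d : ℕ) : rigidMotion d ≤ polyField d 1 := by
  rintro v ⟨a, η, -, hv⟩
  refine ⟨fun i => MvPolynomial.C (a i) + ∑ j, MvPolynomial.C (η i j) * MvPolynomial.X j,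
    fun i => ?_, fun x i => ?_⟩
  · refine (MvPolynomial.totalDegree_add _ _).trans (max_le (by simp) ?_)
    refine MvPolynomial.totalDegree_finsetSum_le fun j _ => ?_
    exact (MvPolynomial.totalDegree_mul _ _).trans (by simp)
  · simp [hv, Matrix.toLpLin_apply, Matrix.mulVec, dotProduct]

instance finiteDimensional_polyField (d r : ℕ) : FiniteDimensional ℝ (polyField d r) := by
  let φ : polyField d r →ₗ[ℝ] (E d → Fin d → ℝ) :=
    { toFun := fun v x i => v.1 x i
      map_add' := fun v w => rfl
      map_smul' := fun c v => rfl }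
  let ψ : (Fin d → MvPolynomial.restrictTotalDegree (Fin d) ℝ r) →ₗ[ℝ] (E d → Fin d → ℝ) :=
    { toFun := fun p x i => MvPolynomial.eval (fun j => x j) (p i).1
      map_add' := fun p q => by ext x i; simp
      map_smul' := fun c p => by ext x i; simp [MvPolynomial.smul_eval] }
  have hφ : Function.Injective φ := by
    intro v w h
    ext x i
    exact congrFun (congrFun h x) i
  have hle : LinearMap.range φ ≤ LinearMap.range ψ := by
    rintro _ ⟨⟨v, p, hp, hv⟩, rfl⟩
    refine ⟨fun i => ⟨p i, (MvPolynomial.mem_restrictTotalDegree _ _ _).2 (hp i)⟩, ?_⟩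
    ext x i
    exact (hv x i).symm
  have : FiniteDimensional ℝ (LinearMap.range φ) := Submodule.finiteDimensional_of_le hle
  exact LinearEquiv.finiteDimensional (LinearEquiv.ofInjective φ hφ).symm

instance finiteDimensional_faceSpace {d : ℕ} (k : ℕ) {e : Set (E d)}
    (h : IsPolytope (d - 1) e) : FiniteDimensional ℝ (faceSpace k h) := by
  have : FiniteDimensional ℝ (rigidMotion d) := Submodule.finiteDimensional_of_le (rigidMotion_le d)
  unfold faceSpace
  infer_instance

/-- The `L²` projection `Q_b` of `[L²(e)]^d` onto `V_{k-1}(e)`. -/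
def Qb {d : ℕ} (k : ℕ) {e : Set (E d)} (h : IsPolytope (d - 1) e) : FaceL2 e →L[ℝ] FaceL2 e :=
  (faceSpace k h).starProjection

/-- The strain tensor `ε(v) = (∇v + ∇vᵀ) / 2`. -/
def strain {d : ℕ} (v : C(E d, E d)) (x : E d) : Matrix (Fin d) (Fin d) ℝ := fun i j =>
  (fderiv ℝ v x (EuclideanSpace.single j 1) i + fderiv ℝ v x (EuclideanSpace.single i 1) j) / 2

namespace Partition

variable {d : ℕ} {Ω : Set (E d)} (𝒯 : Partition Ω)

/-- Pairs `v = {v_0, v_b}`: a vector field `v_0` for each element and an `L²` vector field `v_b` on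
each face.  The faces are not doubled, so that `v_b` is single-valued on the interfaces. -/
abbrev WeakFunction : Type :=
  (𝒯.cells → C(E d, E d)) × ((e : 𝒯.faces) → FaceL2 (e : Set (E d)))

/-- The weak finite element space `V_h`: `v_0 ∈ [P_k(T)]^d` on each element `T` and
`v_b ∈ V_{k-1}(e)` on each face `e`. -/
def Vh (k : ℕ) : Submodule ℝ 𝒯.WeakFunction where
  carrier := {v | (∀ T, v.1 T ∈ polyField d k) ∧
    ∀ e : 𝒯.faces, v.2 e ∈ faceSpace k (𝒯.isPolytope_face e e.2)}
  add_mem' := fun hv hw =>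
    ⟨fun T => add_mem (hv.1 T) (hw.1 T), fun e => add_mem (hv.2 e) (hw.2 e)⟩
  zero_mem' := ⟨fun _ => zero_mem _, fun _ => zero_mem _⟩
  smul_mem' := fun c _ hv =>
    ⟨fun T => Submodule.smul_mem _ c (hv.1 T), fun e => Submodule.smul_mem _ c (hv.2 e)⟩

/-- The subspace `V_h^0` of the `v ∈ V_h` with `v_b = 0` on `∂Ω`. -/
def Vh0 (k : ℕ) : Submodule ℝ 𝒯.WeakFunction where
  carrier := {v | v ∈ 𝒯.Vh k ∧ ∀ e : 𝒯.faces, (e : Set (E d)) ⊆ frontier Ω → v.2 e = 0}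
  add_mem' := fun hv hw => ⟨add_mem hv.1 hw.1, fun e he => by
    rw [Prod.snd_add, Pi.add_apply, hv.2 e he, hw.2 e he, add_zero]⟩
  zero_mem' := ⟨zero_mem _, fun _ _ => rfl⟩
  smul_mem' := fun c _ hv => ⟨Submodule.smul_mem _ c hv.1, fun e he => by
    rw [Prod.smul_snd, Pi.smul_apply, hv.2 e he, smul_zero]⟩

open scoped Classical in
/-- `(∑_T (‖ε(v_0)‖_T² + h_T⁻¹ ‖Q_b v_0 - v_b‖_{∂T}²))^{1/2}`. -/
def tripleNorm (k : ℕ) (v : 𝒯.WeakFunction) : ℝ :=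
  Real.sqrt (∑ T : 𝒯.cells,
    ((∫ x in (T : Set (E d)), ∑ i, ∑ j, strain (v.1 T) x i j ^ 2) +
      (Metric.diam (T : Set (E d)))⁻¹ *
        ∑ e : 𝒯.faces, if (e : Set (E d)) ⊆ frontier (T : Set (E d)) then
          ‖Qb k (𝒯.isPolytope_face e e.2) (trace (𝒯.isPolytope_face e e.2) (v.1 T)) - v.2 e‖ ^ 2
        else 0))

end Partition

end WG

end

/-!
The triple norm of `v` is the norm of `(ε(v_0), h_T^{-1/2} (Q_b v_0 - v_b))_T`, a linear
function of `v` with values in a product of `L²` spaces, so it is a seminorm. If it vanishes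
then `v_0` is a rigid motion on every element, `Q_b` fixes the traces of `v_0`, and `v_b` is the
trace of `v_0` from every element that contains the face. A rigid motion is determined by its
values on a set that spans a hyperplane, because the range of a skew-symmetric map orthogonal to
its kernel cannot have dimension one. Hence `v_0 = 0` passes from one element to another across
a common face, and it holds on every element with a face on `∂Ω`.

Every element is reached in this way: otherwise the union of the elements where `v_0 ≠ 0` is a
compact set with nonempty interior. Sets of codimension two do not disconnect open sets, so its
boundary has a point that is not in the relative boundary of a face. Near that point there is a
single face, which is part of `∂Ω` or separates exactly two elements.
-/

noncomputable section

namespace WG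

open MeasureTheory
open scoped ContDiff

section IntrinsicInterior

variable {F : Type*} [NormedAddCommGroup F] [NormedSpace ℝ F] {s t : Set F} {x y : F}

theorem mem_intrinsicInterior_iff_exists_isOpen :
    x ∈ intrinsicInterior ℝ s ↔
      x ∈ affineSpan ℝ s ∧ ∃ U, IsOpen U ∧ x ∈ U ∧ U ∩ affineSpan ℝ s ⊆ s := by
  rw [mem_intrinsicInterior]
  constructor
  · rintro ⟨y, hy, rfl⟩
    obtain ⟨t, hts, hto, hyt⟩ := mem_interior.1 hy
    obtain ⟨U, hU, rfl⟩ := isOpen_induced_iff.1 hto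
    exact ⟨y.2, U, hU, hyt, fun z hz => hts (a := ⟨z, hz.2⟩) hz.1⟩
  · rintro ⟨hx, U, hU, hxU, hUs⟩
    exact ⟨⟨x, hx⟩, mem_interior.2 ⟨_, fun z hz => hUs ⟨hz, z.2⟩,
      hU.preimage continuous_subtype_val, hxU⟩, rfl⟩

theorem intrinsicInterior_mono_of_affineSpan_eq (hst : s ⊆ t)
    (h : affineSpan ℝ s = affineSpan ℝ t) : intrinsicInterior ℝ s ⊆ intrinsicInterior ℝ t := by
  intro x hx
  rw [mem_intrinsicInterior_iff_exists_isOpen, h] at hx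
  obtain ⟨hxt, U, hU, hxU, hUs⟩ := hx
  exact mem_intrinsicInterior_iff_exists_isOpen.2 ⟨hxt, U, hU, hxU, hUs.trans hst⟩

theorem intrinsicInterior_eq_interior_of_affineSpan_eq_top (h : affineSpan ℝ s = ⊤) :
    intrinsicInterior ℝ s = interior s := by
  refine Set.Subset.antisymm (fun x hx => ?_) interior_subset_intrinsicInterior
  rw [mem_intrinsicInterior_iff_exists_isOpen, h] at hx
  obtain ⟨-, U, hU, hxU, hUs⟩ := hx
  exact mem_interior.2 ⟨U, fun z hz => hUs ⟨hz, trivial⟩, hU, hxU⟩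

theorem openSegment_subset_intrinsicInterior (hs : Convex ℝ s)
    (hx : x ∈ intrinsicInterior ℝ s) (hy : y ∈ s) :
    openSegment ℝ y x ⊆ intrinsicInterior ℝ s := by
  obtain ⟨hxs, U, hU, hxU, hUs⟩ := mem_intrinsicInterior_iff_exists_isOpen.1 hx
  have hys := subset_affineSpan ℝ s hy
  rw [openSegment_eq_image_lineMap]
  rintro _ ⟨t, ⟨ht0, ht1⟩, rfl⟩
  -- The homothety about `y` that takes `lineMap y x t` to `x` pulls `U` back to a neighbourhood.
  refine mem_intrinsicInterior_iff_exists_isOpen.2 ⟨AffineMap.lineMap_mem t hys hxs,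
    AffineMap.homothety y t⁻¹ ⁻¹' U, hU.preimage (AffineMap.homothety_continuous _ _), ?_, ?_⟩
  · simpa [AffineMap.homothety_apply, AffineMap.lineMap_apply, smul_smul, ht0.ne'] using hxU
  · rintro u ⟨huU, hu⟩
    have hus : AffineMap.homothety y t⁻¹ u ∈ s :=
      hUs ⟨huU, AffineMap.homothety_eq_lineMap y t⁻¹ u ▸ AffineMap.lineMap_mem _ hys hu⟩
    have hmul : AffineMap.homothety y t (AffineMap.homothety y t⁻¹ u) = u := by
      rw [← AffineMap.homothety_mul_apply, mul_inv_cancel₀ ht0.ne', AffineMap.homothety_one,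
        AffineMap.id_apply]
    rw [← hmul, AffineMap.homothety_eq_lineMap]
    exact hs.segment_subset hy hus (segment_eq_image_lineMap ℝ y _ ▸ ⟨t, ⟨ht0.le, ht1.le⟩, rfl⟩)

variable [FiniteDimensional ℝ F]

theorem subset_closure_intrinsicInterior_of_convex (hs : Convex ℝ s) :
    s ⊆ closure (intrinsicInterior ℝ s) := by
  intro y hy
  obtain ⟨x, hx⟩ := Set.Nonempty.intrinsicInterior hs ⟨y, hy⟩
  exact closure_mono (openSegment_subset_intrinsicInterior hs hx hy)
    (segment_subset_closure_openSegment (left_mem_segment ℝ y x))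

theorem affineSpan_eq_of_subset_of_finrank_le (hst : s ⊆ t) (hs : s.Nonempty)
    (h : Module.finrank ℝ (vectorSpan ℝ t) ≤ Module.finrank ℝ (vectorSpan ℝ s)) :
    affineSpan ℝ s = affineSpan ℝ t := by
  refine AffineSubspace.eq_of_direction_eq_of_nonempty_of_le ?_ ((affineSpan_nonempty ℝ).2 hs)
    (affineSpan_mono ℝ hst)
  rw [direction_affineSpan, direction_affineSpan]
  exact Submodule.eq_of_le_of_finrank_le (vectorSpan_mono ℝ hst) h

theorem sum_smul_mem_intrinsicInterior_convexHull {t : Finset F} {w : F → ℝ}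
    (hw : ∀ y ∈ t, 0 < w y) (hw1 : ∑ y ∈ t, w y = 1) :
    ∑ y ∈ t, w y • y ∈ intrinsicInterior ℝ (convexHull ℝ (t : Set F)) := by
  have ht : t.Nonempty := Finset.nonempty_of_sum_ne_zero (hw1 ▸ one_ne_zero)
  have hconv := convex_convexHull ℝ (t : Set F)
  obtain ⟨x, hx⟩ := Set.Nonempty.intrinsicInterior hconv ht.to_set.convexHull
  obtain ⟨a, ha, ha1, hax⟩ := Finset.mem_convexHull'.1 (intrinsicInterior_subset hx)
  obtain ⟨y₀, hy₀, hmin⟩ := t.exists_min_image w ht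
  set ε := w y₀
  have hε0 : 0 < ε := hw y₀ hy₀
  have hz : ∑ y ∈ t, ((1 + ε) * w y - ε * a y) • y ∈ convexHull ℝ (t : Set F) := by
    refine Finset.mem_convexHull'.2 ⟨_, fun y hy => ?_, ?_, rfl⟩
    · have ha_le : a y ≤ 1 := ha1 ▸ Finset.single_le_sum ha hy
      nlinarith [hmin y hy, hw y hy, mul_pos hε0 (hw y hy)]
    · rw [Finset.sum_sub_distrib, ← Finset.mul_sum, ← Finset.mul_sum, hw1, ha1]
      ring
  refine openSegment_subset_intrinsicInterior hconv hx hz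
    ⟨1 / (1 + ε), ε / (1 + ε), by positivity, by positivity, by field_simp, ?_⟩
  rw [← hax, Finset.smul_sum, Finset.smul_sum, ← Finset.sum_add_distrib]
  refine Finset.sum_congr rfl fun y _ => ?_
  rw [smul_smul, smul_smul, ← add_smul]
  congr 1
  field_simp
  ring

theorem exists_subset_mem_intrinsicInterior_convexHull {P : Finset F}
    (hx : x ∈ convexHull ℝ (P : Set F)) :
    ∃ t ⊆ P, x ∈ intrinsicInterior ℝ (convexHull ℝ (t : Set F)) := by
  classical
  obtain ⟨w, hw, hw1, rfl⟩ := Finset.mem_convexHull'.1 hx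
  have hzero : ∀ y ∈ P, y ∉ P.filter (0 < w ·) → w y = 0 := fun y hy hyt =>
    (hw y hy).antisymm' (not_lt.1 fun h => hyt (Finset.mem_filter.2 ⟨hy, h⟩))
  refine ⟨P.filter (0 < w ·), P.filter_subset _, ?_⟩
  rw [← Finset.sum_subset (P.filter_subset _) fun y hy hyt => by rw [hzero y hy hyt, zero_smul]]
  refine sum_smul_mem_intrinsicInterior_convexHull (fun y hy => (Finset.mem_filter.1 hy).2) ?_
  rw [Finset.sum_subset (P.filter_subset _) hzero, hw1]

end IntrinsicInterior

namespace IsPolytope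

variable {d n : ℕ} {S : Set (E d)}

theorem isClosed (h : IsPolytope n S) : IsClosed S :=
  h.isCompact.isClosed

theorem affineSpan_eq_of_subset (h : IsPolytope n S) {t : Set (E d)} (ht : t ⊆ S)
    (hne : t.Nonempty) (hn : n ≤ Module.finrank ℝ (vectorSpan ℝ t)) :
    affineSpan ℝ t = affineSpan ℝ S :=
  affineSpan_eq_of_subset_of_finrank_le ht hne (h.finrank_vectorSpan.trans_le hn)

theorem subset_closure_intrinsicInterior (h : IsPolytope n S) :
    S ⊆ closure (intrinsicInterior ℝ S) := by
  obtain ⟨F, hF, hS⟩ := h.exists_pieces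
  intro y hy
  obtain ⟨P, hP, hyP⟩ := Set.mem_iUnion₂.1 (hS ▸ hy)
  have hPS : convexHull ℝ (P : Set (E d)) ⊆ S := by
    rw [hS]
    exact Set.subset_iUnion₂_of_subset P hP subset_rfl
  have hspan : affineSpan ℝ (convexHull ℝ (P : Set (E d))) = affineSpan ℝ S := by
    refine h.affineSpan_eq_of_subset hPS ⟨y, hyP⟩ ?_
    rw [← direction_affineSpan, affineSpan_convexHull, direction_affineSpan, hF P hP]
  exact closure_mono (intrinsicInterior_mono_of_affineSpan_eq hPS hspan)
    (subset_closure_intrinsicInterior_of_convex (convex_convexHull ℝ _) hyP)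

theorem intrinsicInterior_eq_interior (h : IsPolytope d S) :
    intrinsicInterior ℝ S = interior S := by
  refine intrinsicInterior_eq_interior_of_affineSpan_eq_top ?_
  rw [AffineSubspace.affineSpan_eq_top_iff_vectorSpan_eq_top_of_nonempty ℝ _ _
    (h.isConnected_interior.nonempty.mono intrinsicInterior_subset)]
  exact Submodule.eq_top_of_finrank_eq (by rw [h.finrank_vectorSpan, finrank_euclideanSpace_fin])

theorem subset_closure_interior (h : IsPolytope d S) : S ⊆ closure (interior S) :=
  h.intrinsicInterior_eq_interior ▸ h.subset_closure_intrinsicInterior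

theorem nonempty_interior (h : IsPolytope d S) : (interior S).Nonempty :=
  h.intrinsicInterior_eq_interior ▸ h.isConnected_interior.nonempty

theorem exists_intrinsicFrontier_subset (h : IsPolytope n S) :
    ∃ 𝒜 : Set (AffineSubspace ℝ (E d)), 𝒜.Finite ∧
      (∀ A ∈ 𝒜, Module.finrank ℝ A.direction < n) ∧ intrinsicFrontier ℝ S ⊆ ⋃ A ∈ 𝒜, A := by
  obtain ⟨F, -, hS⟩ := h.exists_pieces
  classical
  let V : Finset (Finset (E d)) := F.biUnion Finset.powerset
  refine ⟨{A ∈ (fun t : Finset (E d) => affineSpan ℝ (t : Set (E d))) '' V |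
    Module.finrank ℝ A.direction < n}, (V.finite_toSet.image _).subset (Set.sep_subset _ _),
    fun A hA => hA.2, fun x hx => ?_⟩
  obtain ⟨P, hP, hxP⟩ := Set.mem_iUnion₂.1 (hS ▸ intrinsicFrontier_subset h.isClosed hx)
  obtain ⟨t, htP, hxt⟩ := exists_subset_mem_intrinsicInterior_convexHull hxP
  have hxt' := intrinsicInterior_subset hxt
  refine Set.mem_biUnion (x := affineSpan ℝ (t : Set (E d)))
    ⟨⟨t, Finset.mem_biUnion.2 ⟨P, hP, Finset.mem_powerset.2 htP⟩, rfl⟩, ?_⟩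
    (convexHull_subset_affineSpan _ hxt')
  by_contra! hn
  have htS : convexHull ℝ (t : Set (E d)) ⊆ S := by
    rw [hS]
    exact Set.subset_iUnion₂_of_subset P hP (convexHull_mono htP)
  rw [← affineSpan_convexHull, direction_affineSpan] at hn
  have hxS := intrinsicInterior_mono_of_affineSpan_eq htS
    (h.affineSpan_eq_of_subset htS ⟨x, hxt'⟩ hn) hxt
  rw [← closure_sdiff_intrinsicInterior] at hx
  exact hx.2 hxS

end IsPolytope

section Genericity

variable {F : Type*} [NormedAddCommGroup F] [NormedSpace ℝ F] [FiniteDimensional ℝ F]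
  {U V : Set F} {𝒜 : Set (AffineSubspace ℝ F)}

theorem nonempty_diff_biUnion_affineSubspace (hU : IsOpen U) (hne : U.Nonempty)
    (h𝒜 : 𝒜.Countable) (hA : ∀ A ∈ 𝒜, A ≠ ⊤) : (U \ ⋃ A ∈ 𝒜, (A : Set F)).Nonempty := by
  borelize F
  rw [Set.sdiff_nonempty]
  intro hsub
  have hnull : (Measure.addHaar : Measure F) (⋃ A ∈ 𝒜, (A : Set F)) = 0 :=
    (measure_biUnion_null_iff h𝒜).2 fun A h => Measure.addHaar_affineSubspace _ A (hA A h)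
  exact (hU.measure_pos _ hne).ne' (measure_mono_null hsub hnull)

theorem exists_segment_disjoint_biUnion_affineSubspace (hU : IsOpen U) (hUne : U.Nonempty)
    (hV : IsOpen V) (hVne : V.Nonempty) (h𝒜 : 𝒜.Countable)
    (hA : ∀ A ∈ 𝒜, Module.finrank ℝ A.direction + 1 < Module.finrank ℝ F) :
    ∃ p ∈ U, ∃ q ∈ V, Disjoint (segment ℝ p q) (⋃ A ∈ 𝒜, (A : Set F)) := by
  have hne_top : ∀ B : AffineSubspace ℝ F, Module.finrank ℝ B.direction < Module.finrank ℝ F →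
      B ≠ ⊤ := by
    rintro _ hB rfl
    rw [AffineSubspace.direction_top, finrank_top] at hB
    exact hB.false
  obtain ⟨p, hp, hpA⟩ := nonempty_diff_biUnion_affineSubspace hU hUne h𝒜 fun A h =>
    hne_top A (Nat.lt_of_succ_lt (hA A h))
  -- A segment from `p` that meets `A` away from `p` ends in the span of `p` and `A`.
  obtain ⟨q, hq, hqA⟩ := nonempty_diff_biUnion_affineSubspace hV hVne
    (h𝒜.image fun A => affineSpan ℝ (insert p (A : Set F))) <| by
      rintro _ ⟨A, h, rfl⟩
      refine hne_top _ ?_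
      rw [direction_affineSpan]
      exact (finrank_vectorSpan_insert_le A p).trans_lt (hA A h)
  refine ⟨p, hp, q, hq, Set.disjoint_left.2 fun x hx hxA => ?_⟩
  obtain ⟨A, h, hxA⟩ := Set.mem_iUnion₂.1 hxA
  rw [segment_eq_image_lineMap] at hx
  obtain ⟨t, -, rfl⟩ := hx
  rcases eq_or_ne t 0 with rfl | ht
  · exact hpA (Set.mem_biUnion h (by simpa using hxA))
  · have hmem := AffineMap.lineMap_mem t⁻¹ (mem_affineSpan ℝ (Set.mem_insert p (A : Set F)))
      (subset_affineSpan ℝ _ (Set.mem_insert_of_mem p hxA))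
    have hq_eq : AffineMap.lineMap p (AffineMap.lineMap p q t) t⁻¹ = q := by
      simp [AffineMap.lineMap_apply, smul_smul, inv_mul_cancel₀ ht]
    exact hqA (Set.mem_biUnion ⟨A, h, rfl⟩ (hq_eq ▸ hmem))

end Genericity

section HausdorffMeasure

variable {F : Type*} [NormedAddCommGroup F] [InnerProductSpace ℝ F] [FiniteDimensional ℝ F]
  [MeasurableSpace F] [BorelSpace F] {A : AffineSubspace ℝ F}

theorem euclideanHausdorffMeasure_affineSubspace_eq_zero {n : ℕ}
    (hn : Module.finrank ℝ A.direction < n) :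
    Measure.euclideanHausdorffMeasure n (A : Set F) = 0 := by
  rcases (A : Set F).eq_empty_or_nonempty with hA | hA
  · rw [hA, measure_empty]
  · have hdim : dimH (A : Set F) < (n : NNReal) := by
      rw [Real.Convex.dimH_eq_finrank_vectorSpan A.convex hA,
        ← AffineSubspace.direction_eq_vectorSpan]
      exact_mod_cast hn
    rw [Measure.euclideanHausdorffMeasure_def, Measure.smul_apply]
    simpa using Or.inr (hausdorffMeasure_of_dimH_lt hdim)

theorem euclideanHausdorffMeasure_open_inter_affineSubspace_pos {U : Set F} (hU : IsOpen U)
    (hne : (U ∩ A).Nonempty) :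
    0 < Measure.euclideanHausdorffMeasure (Module.finrank ℝ A.direction) (U ∩ A) := by
  obtain ⟨x, hxU, hxA⟩ := hne
  have : Nonempty A := ⟨⟨x, hxA⟩⟩
  have himage : ((↑) : A → F) '' ((↑) ⁻¹' U) = U ∩ A :=
    (Subtype.image_preimage_coe _ _).trans (Set.inter_comm _ _)
  have hUA : IsOpen (((↑) : A → F) ⁻¹' U) := hU.preimage continuous_subtype_val
  have hcont := (IsometryEquiv.vaddConst (⟨x, hxA⟩ : A)).continuous
  rw [← himage, AffineSubspace.euclideanHausdorffMeasure_coe_image,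
    EuclideanGeometry.euclideanHausdorffMeasure_eq (⟨x, hxA⟩ : A),
    Measure.map_apply hcont.measurable hUA.measurableSet]
  exact (hUA.preimage hcont).measure_pos _ ⟨0, by simpa using hxU⟩

end HausdorffMeasure

namespace IsPolytope

variable {d n : ℕ} {S : Set (E d)}

theorem euclideanHausdorffMeasure_open_inter_pos (h : IsPolytope n S) {V : Set (E d)}
    (hV : IsOpen V) (hne : (V ∩ S).Nonempty) :
    0 < Measure.euclideanHausdorffMeasure n (V ∩ S) := by
  obtain ⟨y, hyV, hyS⟩ := hne
  obtain ⟨x, hxV, hx⟩ := mem_closure_iff.1 (h.subset_closure_intrinsicInterior hyS) V hV hyV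
  obtain ⟨hxS, U, hU, hxU, hUS⟩ := mem_intrinsicInterior_iff_exists_isOpen.1 hx
  have hpos := euclideanHausdorffMeasure_open_inter_affineSubspace_pos (hV.inter hU)
    (A := affineSpan ℝ S) ⟨x, ⟨hxV, hxU⟩, hxS⟩
  rw [direction_affineSpan, h.finrank_vectorSpan] at hpos
  exact hpos.trans_le (measure_mono fun z hz => ⟨hz.1.1, hUS ⟨hz.1.2, hz.2⟩⟩)

theorem subset_closure_diff_of_null (h : IsPolytope n S) {N : Set (E d)}
    (hN : Measure.euclideanHausdorffMeasure n N = 0) : S ⊆ closure (S \ N) := by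
  refine fun y hy => mem_closure_iff.2 fun V hV hyV => ?_
  by_contra hempty
  refine (h.euclideanHausdorffMeasure_open_inter_pos hV ⟨y, hyV, hy⟩).ne'
    (measure_mono_null (fun z hz => ?_) hN)
  by_contra hzN
  exact hempty ⟨z, hz.1, hz.2, hzN⟩

end IsPolytope

section Topology

variable {X : Type*} [TopologicalSpace X] {s : Set X}

theorem subset_interior_or_disjoint_of_disjoint_frontier {t : Set X} (hs : IsPreconnected s)
    (h : Disjoint s (frontier t)) : s ⊆ interior t ∨ Disjoint s t := by
  have hcover : s ⊆ interior t ∪ (closure t)ᶜ := fun x hx => by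
    by_contra hx'
    rw [Set.mem_union, not_or, Set.mem_compl_iff, not_not] at hx'
    exact Set.disjoint_left.1 h hx ⟨hx'.2, hx'.1⟩
  have hdisj : Disjoint (interior t) (closure t)ᶜ :=
    disjoint_compl_right.mono_left (interior_subset.trans subset_closure)
  exact (hs.subset_or_subset isOpen_interior isClosed_closure.isOpen_compl hdisj hcover).imp_right
    fun hsub => (Set.disjoint_compl_left_iff_subset.2 subset_closure).mono_left hsub

theorem eventually_forall_mem_of_mem (C : Finset (Set X)) (hC : ∀ t ∈ C, IsClosed t) (z : X) :
    ∀ᶠ y in nhds z, ∀ t ∈ C, y ∈ t → z ∈ t := by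
  refine (Filter.eventually_all_finset C).2 fun t ht => ?_
  by_cases hz : z ∈ t
  · exact Filter.Eventually.of_forall fun _ _ => hz
  · filter_upwards [(hC t ht).isOpen_compl.mem_nhds hz] with y hy hyt
    exact absurd hyt hy

end Topology

section Hyperplane

variable {F : Type*} [NormedAddCommGroup F] [NormedSpace ℝ F] {f : StrongDual ℝ F} {c : ℝ}
  {U S T : Set F}

theorem halfSpace_inter_subset_interior (hf : f ≠ 0) (hU : IsOpen U) (hUc : Convex ℝ U)
    (hS : S ⊆ closure (interior S)) (hUS : (U ∩ S).Nonempty)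
    (hflat : U ∩ frontier S ⊆ f ⁻¹' {c}) :
    ((U ∩ f ⁻¹' Set.Ioi c).Nonempty ∧ U ∩ f ⁻¹' Set.Ioi c ⊆ interior S) ∨
      ((U ∩ f ⁻¹' Set.Iio c).Nonempty ∧ U ∩ f ⁻¹' Set.Iio c ⊆ interior S) := by
  have key : ∀ I : Set ℝ, Convex ℝ I → c ∉ I → (U ∩ interior S ∩ f ⁻¹' I).Nonempty →
      (U ∩ f ⁻¹' I).Nonempty ∧ U ∩ f ⁻¹' I ⊆ interior S := by
    rintro I hI hcI ⟨y, ⟨hyU, hyS⟩, hyI⟩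
    have hfr : Disjoint (U ∩ f ⁻¹' I) (frontier S) := Set.disjoint_left.2 fun x hx hxS =>
      hcI (hflat ⟨hx.1, hxS⟩ ▸ hx.2)
    have hconn := (hUc.inter (hI.linear_preimage f.toLinearMap)).isPreconnected
    exact ⟨⟨y, hyU, hyI⟩, (subset_interior_or_disjoint_of_disjoint_frontier hconn
      hfr).resolve_right fun h => Set.disjoint_left.1 h ⟨hyU, hyI⟩ (interior_subset hyS)⟩
  obtain ⟨x, hxU, hxS⟩ := hUS
  obtain ⟨y, hy, hyc⟩ := ((dense_compl_singleton c).preimage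
    (f.isOpenMap_of_ne_zero hf)).inter_open_nonempty _ (hU.inter isOpen_interior)
      (mem_closure_iff.1 (hS hxS) U hU hxU)
  rcases lt_or_gt_of_ne hyc with h | h
  · exact Or.inr (key _ (convex_Iio c) (lt_irrefl c) ⟨y, hy, h⟩)
  · exact Or.inl (key _ (convex_Ioi c) (lt_irrefl c) ⟨y, hy, h⟩)

theorem subset_union_of_frontier_subset_hyperplane (hf : f ≠ 0) (hU : IsOpen U)
    (hUc : Convex ℝ U) (hS : IsClosed S) (hT : IsClosed T) (hSr : S ⊆ closure (interior S))
    (hTr : T ⊆ closure (interior T)) (hST : Disjoint (interior S) (interior T))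
    (hUS : (U ∩ S).Nonempty) (hUT : (U ∩ T).Nonempty)
    (hSflat : U ∩ frontier S ⊆ f ⁻¹' {c}) (hTflat : U ∩ frontier T ⊆ f ⁻¹' {c}) :
    U ⊆ S ∪ T := by
  suffices h : U ∩ f ⁻¹' {c}ᶜ ⊆ S ∪ T by
    refine (hS.union hT).closure_subset_iff.2 h |>.trans' ?_
    exact ((dense_compl_singleton c).preimage (f.isOpenMap_of_ne_zero hf)).open_subset_closure_inter
      hU
  have hsplit : U ∩ f ⁻¹' {c}ᶜ ⊆ (U ∩ f ⁻¹' Set.Ioi c) ∪ (U ∩ f ⁻¹' Set.Iio c) :=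
    fun y hy => (lt_or_gt_of_ne hy.2).symm.imp (⟨hy.1, ·⟩) (⟨hy.1, ·⟩)
  refine hsplit.trans ?_
  have hdisj : ∀ {A : Set F}, A.Nonempty → A ⊆ interior S → ¬ A ⊆ interior T :=
    fun ⟨y, hy⟩ h h' => Set.disjoint_left.1 hST (h hy) (h' hy)
  rcases halfSpace_inter_subset_interior hf hU hUc hSr hUS hSflat with ⟨hn, h⟩ | ⟨hn, h⟩ <;>
    rcases halfSpace_inter_subset_interior hf hU hUc hTr hUT hTflat with ⟨-, h'⟩ | ⟨-, h'⟩
  · exact absurd h' (hdisj hn h)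
  · exact Set.union_subset_union (h.trans interior_subset) (h'.trans interior_subset)
  · rw [Set.union_comm S]
    exact Set.union_subset_union (h'.trans interior_subset) (h.trans interior_subset)
  · exact absurd h' (hdisj hn h)

end Hyperplane

section Frontier

variable {F : Type*} [NormedAddCommGroup F] [NormedSpace ℝ F] [FiniteDimensional ℝ F]
  {𝒜 : Set (AffineSubspace ℝ F)}

theorem exists_mem_frontier_notMem_biUnion_affineSubspace (h𝒜 : 𝒜.Countable)
    (hA : ∀ A ∈ 𝒜, Module.finrank ℝ A.direction + 1 < Module.finrank ℝ F) {Y : Set F}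
    (hY : IsClosed Y) (hint : (interior Y).Nonempty) (hne : Y ≠ Set.univ) :
    ∃ z ∈ frontier Y, z ∉ ⋃ A ∈ 𝒜, (A : Set F) := by
  obtain ⟨p, hp, q, hq, hpq⟩ := exists_segment_disjoint_biUnion_affineSubspace isOpen_interior hint
    hY.isOpen_compl (Set.nonempty_compl.2 hne) h𝒜 hA
  by_contra! hcon
  rcases subset_interior_or_disjoint_of_disjoint_frontier (convex_segment p q).isPreconnected
    (hpq.mono_right hcon) with h | h
  · exact hq (interior_subset (h (right_mem_segment ℝ p q)))
  · exact Set.disjoint_left.1 h (left_mem_segment ℝ p q) (interior_subset hp)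

end Frontier

theorem exists_strongDual_ne_zero_forall_mem_eq {F : Type*} [NormedAddCommGroup F]
    [NormedSpace ℝ F] [FiniteDimensional ℝ F] {s : Set F}
    (hs : Module.finrank ℝ (vectorSpan ℝ s) < Module.finrank ℝ F) :
    ∃ f : StrongDual ℝ F, f ≠ 0 ∧ ∀ x ∈ s, ∀ y ∈ s, f x = f y := by
  have hlt : vectorSpan ℝ s < ⊤ := lt_top_iff_ne_top.2 fun h => by
    rw [h, finrank_top] at hs
    exact hs.false
  obtain ⟨g, hg, hker⟩ := Submodule.exists_le_ker_of_lt_top _ hlt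
  refine ⟨LinearMap.toContinuousLinearMap g, by simpa using hg, fun x hx y hy => ?_⟩
  have := hker (vsub_mem_vectorSpan ℝ hx hy)
  rwa [LinearMap.mem_ker, vsub_eq_sub, map_sub, sub_eq_zero] at this

namespace Partition

variable {d : ℕ} {Ω : Set (E d)} {𝒯 : Partition Ω} {e T T' : Set (E d)} {z : E d}

theorem cell_subset_closure (hT : T ∈ 𝒯.cells) : T ⊆ closure Ω :=
  𝒯.iUnion_cells ▸ Set.subset_iUnion₂_of_subset T hT subset_rfl

theorem mem_frontier_of_mem_of_ne (hT : T ∈ 𝒯.cells) (hT' : T' ∈ 𝒯.cells) (hne : T ≠ T')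
    (hz : z ∈ T) (hz' : z ∈ T') : z ∈ frontier T := by
  refine ⟨subset_closure hz, fun hzi => ?_⟩
  obtain ⟨y, hy, hy'⟩ := mem_closure_iff.1 ((𝒯.isPolytope_cell T' hT').subset_closure_interior hz')
    _ isOpen_interior hzi
  exact Set.disjoint_left.1 (𝒯.disjoint_cells T hT T' hT' hne) hy hy'

theorem exists_face_of_mem_frontier (hT : T ∈ 𝒯.cells) (hz : z ∈ frontier T) :
    ∃ e ∈ 𝒯.faces, e ⊆ frontier T ∧ z ∈ e := by
  rw [𝒯.frontier_cell T hT] at hz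
  simpa only [Set.mem_iUnion, exists_prop] using hz

variable (𝒯) in
/-- The union of the relative boundaries of the faces: the vertices (`d = 2`) or the edges
(`d = 3`) of the partition.  Away from it the partition looks like a hyperplane between two half
spaces. -/
def skeleton : Set (E d) :=
  ⋃ e ∈ 𝒯.faces, intrinsicFrontier ℝ e

variable (𝒯) in
theorem exists_skeleton_subset :
    ∃ 𝒜 : Set (AffineSubspace ℝ (E d)), 𝒜.Countable ∧
      (∀ A ∈ 𝒜, Module.finrank ℝ A.direction < d - 1) ∧ 𝒯.skeleton ⊆ ⋃ A ∈ 𝒜, A := by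
  choose! 𝒜 hfin hdim hsub using fun e he =>
    (𝒯.isPolytope_face e he).exists_intrinsicFrontier_subset
  refine ⟨⋃ e ∈ 𝒯.faces, 𝒜 e, 𝒯.faces.countable_toSet.biUnion fun e he => (hfin e he).countable,
    fun A hA => ?_, Set.iUnion₂_subset fun e he => (hsub e he).trans ?_⟩
  · obtain ⟨e, he, hAe⟩ := Set.mem_iUnion₂.1 hA
    exact hdim e he A hAe
  · exact Set.biUnion_subset_biUnion_left (Set.subset_iUnion₂_of_subset e he subset_rfl)

variable (𝒯) in
theorem euclideanHausdorffMeasure_skeleton :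
    Measure.euclideanHausdorffMeasure (d - 1) 𝒯.skeleton = 0 := by
  obtain ⟨𝒜, h𝒜, hdim, hsub⟩ := 𝒯.exists_skeleton_subset
  exact measure_mono_null hsub ((measure_biUnion_null_iff h𝒜).2 fun A hA =>
    euclideanHausdorffMeasure_affineSubspace_eq_zero (hdim A hA))

theorem face_subset_closure_diff_skeleton (he : e ∈ 𝒯.faces) : e ⊆ closure (e \ 𝒯.skeleton) :=
  (𝒯.isPolytope_face e he).subset_closure_diff_of_null 𝒯.euclideanHausdorffMeasure_skeleton

theorem mem_intrinsicInterior_face (he : e ∈ 𝒯.faces) (hz : z ∈ e \ 𝒯.skeleton) :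
    z ∈ intrinsicInterior ℝ e := by
  have hzc : z ∈ intrinsicClosure ℝ e := subset_intrinsicClosure hz.1
  rw [← intrinsicInterior_union_intrinsicFrontier] at hzc
  exact hzc.resolve_right fun h => hz.2 (Set.mem_biUnion he h)

theorem face_eq_of_mem_of_mem {e' : Set (E d)} (he : e ∈ 𝒯.faces) (he' : e' ∈ 𝒯.faces)
    (hz : z ∉ 𝒯.skeleton) (hze : z ∈ e) (hze' : z ∈ e') : e = e' := by
  by_contra hne
  exact Set.disjoint_left.1 (𝒯.disjoint_faces e he e' he' hne)
    (mem_intrinsicInterior_face he ⟨hze, hz⟩) (mem_intrinsicInterior_face he' ⟨hze', hz⟩)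

theorem face_subset_frontier_of_mem (he : e ∈ 𝒯.faces) (hz : z ∈ e \ 𝒯.skeleton)
    (hT : T ∈ 𝒯.cells) (hzT : z ∈ frontier T) : e ⊆ frontier T := by
  obtain ⟨e', he', he'T, hze'⟩ := exists_face_of_mem_frontier hT hzT
  rwa [face_eq_of_mem_of_mem he he' hz.2 hz.1 hze']

theorem exists_ball_inter_frontier_subset_hyperplane (hd : 1 ≤ d) (he : e ∈ 𝒯.faces)
    (hz : z ∈ e \ 𝒯.skeleton) : ∃ f : StrongDual ℝ (E d), f ≠ 0 ∧ ∃ r > 0, ∀ T ∈ 𝒯.cells,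
      Metric.ball z r ∩ frontier T ⊆ f ⁻¹' {f z} := by
  have heP := 𝒯.isPolytope_face e he
  obtain ⟨f, hf, hfe⟩ := exists_strongDual_ne_zero_forall_mem_eq (s := e) <| by
    rw [heP.finrank_vectorSpan, finrank_euclideanSpace_fin]
    exact Nat.sub_one_lt_of_lt hd
  obtain ⟨r, hr, hball⟩ := Metric.eventually_nhds_iff_ball.1 <|
    eventually_forall_mem_of_mem 𝒯.faces (fun e' he' => (𝒯.isPolytope_face e' he').isClosed) z
  refine ⟨f, hf, r, hr, fun T hT y ⟨hy, hyT⟩ => ?_⟩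
  obtain ⟨e', he', -, hye'⟩ := exists_face_of_mem_frontier hT hyT
  obtain rfl := face_eq_of_mem_of_mem he he' hz.2 hz.1 (hball y hy e' he' hye')
  exact hfe y hye' z hz.1

theorem mem_interior_union_of_mem_of_mem (hd : 1 ≤ d) (he : e ∈ 𝒯.faces)
    (hz : z ∈ e \ 𝒯.skeleton) (hT : T ∈ 𝒯.cells) (hT' : T' ∈ 𝒯.cells) (hne : T ≠ T')
    (hzT : z ∈ T) (hzT' : z ∈ T') : z ∈ interior (T ∪ T') := by
  obtain ⟨f, hf, r, hr, hflat⟩ := exists_ball_inter_frontier_subset_hyperplane hd he hz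
  have hzr := Metric.mem_ball_self (x := z) hr
  have hTP := 𝒯.isPolytope_cell T hT
  have hTP' := 𝒯.isPolytope_cell T' hT'
  exact mem_interior.2 ⟨_, subset_union_of_frontier_subset_hyperplane hf Metric.isOpen_ball
    (convex_ball z r) hTP.isClosed hTP'.isClosed hTP.subset_closure_interior
    hTP'.subset_closure_interior (𝒯.disjoint_cells T hT T' hT' hne) ⟨z, hzr, hzT⟩ ⟨z, hzr, hzT'⟩
    (hflat T hT) (hflat T' hT'), Metric.isOpen_ball, hzr⟩

theorem face_subset_frontier_domain (he : e ∈ 𝒯.faces) (hT : T ∈ 𝒯.cells) (heT : e ⊆ frontier T)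
    (hunique : ∀ T' ∈ 𝒯.cells, e ⊆ frontier T' → T' = T) : e ⊆ frontier Ω := by
  have hTc := (𝒯.isPolytope_cell T hT).isClosed
  suffices h : e \ 𝒯.skeleton ⊆ frontier (closure Ω) from
    (face_subset_closure_diff_skeleton he).trans
      (isClosed_frontier.closure_subset_iff.2 (h.trans frontier_closure_subset))
  intro y hy
  have hyT : y ∈ T := hTc.frontier_subset (heT hy.1)
  refine ⟨subset_closure (cell_subset_closure hT hyT), fun hyΩ => (heT hy.1).2 ?_⟩
  have honly : ∀ T' ∈ 𝒯.cells, y ∈ T' → T' = T := fun T' hT' hyT' => by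
    by_contra hne
    exact hne (hunique T' hT' (face_subset_frontier_of_mem he hy hT'
      (mem_frontier_of_mem_of_ne hT' hT hne hyT' hyT)))
  rw [mem_interior_iff_mem_nhds] at hyΩ ⊢
  filter_upwards [hyΩ, eventually_forall_mem_of_mem 𝒯.cells
    (fun T' hT' => (𝒯.isPolytope_cell T' hT').isClosed) y] with x hx hlocal
  rw [← 𝒯.iUnion_cells] at hx
  obtain ⟨T', hT', hxT'⟩ := Set.mem_iUnion₂.1 hx
  exact honly T' hT' (hlocal T' hT' hxT') ▸ hxT'

variable (𝒯) in
theorem exists_mem_frontier_notMem_skeleton (hd : 1 ≤ d) {Y : Set (E d)} (hY : IsCompact Y)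
    (hint : (interior Y).Nonempty) : ∃ z ∈ frontier Y, z ∉ 𝒯.skeleton := by
  have : Nonempty (Fin d) := ⟨⟨0, hd⟩⟩
  obtain ⟨𝒜, h𝒜, hdim, hsub⟩ := 𝒯.exists_skeleton_subset
  obtain ⟨z, hz, hz𝒜⟩ := exists_mem_frontier_notMem_biUnion_affineSubspace h𝒜
    (fun A hA => by
      rw [finrank_euclideanSpace_fin]
      exact Nat.add_lt_of_lt_sub (hdim A hA)) hY.isClosed hint hY.ne_univ
  exact ⟨z, hz, fun h => hz𝒜 (hsub h)⟩

/-- The union of the elements where `p` fails is compact, so if there are any then its boundary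
contains a point off the skeleton.  The face through that point is not shared by two such
elements. -/
theorem forall_cell_of_shared_face_of_boundary_face (hd : 1 ≤ d) {p : Set (E d) → Prop}
    (hshared : ∀ T ∈ 𝒯.cells, ∀ T' ∈ 𝒯.cells, ∀ e ∈ 𝒯.faces, e ⊆ frontier T → e ⊆ frontier T' →
      p T' → p T)
    (hboundary : ∀ T ∈ 𝒯.cells, ∀ e ∈ 𝒯.faces, e ⊆ frontier T → e ⊆ frontier Ω → p T) :
    ∀ T ∈ 𝒯.cells, p T := by
  classical
  by_contra! ⟨T₀, hT₀, hpT₀⟩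
  let bad := 𝒯.cells.filter (¬ p ·)
  let Y : Set (E d) := ⋃ T ∈ bad, T
  have hbad : ∀ {T}, T ∈ bad ↔ T ∈ 𝒯.cells ∧ ¬ p T := Finset.mem_filter
  have hsub : ∀ {T}, T ∈ bad → T ⊆ Y := fun hT => Set.subset_iUnion₂_of_subset _ hT subset_rfl
  have hY : IsCompact Y := bad.isCompact_biUnion fun T hT =>
    (𝒯.isPolytope_cell T (hbad.1 hT).1).isCompact
  obtain ⟨z, hzY, hz⟩ := 𝒯.exists_mem_frontier_notMem_skeleton hd hY <|
    (𝒯.isPolytope_cell T₀ hT₀).nonempty_interior.mono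
      (interior_mono (hsub (hbad.2 ⟨hT₀, hpT₀⟩)))
  obtain ⟨T, hTbad, hzT⟩ := Set.mem_iUnion₂.1 (hY.isClosed.frontier_subset hzY)
  obtain ⟨hT, hpT⟩ := hbad.1 hTbad
  obtain ⟨e, he, heT, hze⟩ := exists_face_of_mem_frontier (z := z) hT
    ⟨subset_closure hzT, fun h => hzY.2 (interior_mono (hsub hTbad) h)⟩
  by_cases hunique : ∀ T' ∈ 𝒯.cells, e ⊆ frontier T' → T' = T
  · exact hpT (hboundary T hT e he heT (face_subset_frontier_domain he hT heT hunique))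
  push Not at hunique
  obtain ⟨T', hT', heT', hne⟩ := hunique
  have hpT' : ¬ p T' := fun h => hpT (hshared T hT T' hT' e he heT heT' h)
  have hzT' := (𝒯.isPolytope_cell T' hT').isClosed.frontier_subset (heT' hze)
  exact hzY.2 (interior_mono (Set.union_subset (hsub hTbad) (hsub (hbad.2 ⟨hT', hpT'⟩)))
    (mem_interior_union_of_mem_of_mem hd he ⟨hze, hz⟩ hT hT' hne.symm hzT hzT'))

theorem diam_cell_pos (hd : 1 ≤ d) (hT : T ∈ 𝒯.cells) : 0 < Metric.diam T := by
  have : Nonempty (Fin d) := ⟨⟨0, hd⟩⟩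
  obtain ⟨y, hy⟩ := (𝒯.isPolytope_cell T hT).nonempty_interior
  exact Metric.diam_pos (infinite_of_mem_nhds y (mem_interior_iff_mem_nhds.1 hy)).nontrivial
    (𝒯.isPolytope_cell T hT).isCompact.isBounded

end Partition

section Skew

variable {F : Type*} [NormedAddCommGroup F] [InnerProductSpace ℝ F]

theorem inner_map_eq_neg_of_inner_map_self_eq_zero {L : F →ₗ[ℝ] F}
    (hL : ∀ x, inner ℝ (L x) x = 0) (x y : F) : inner ℝ (L x) y = -inner ℝ (L y) x := by
  have h := hL (x + y)
  rw [map_add, inner_add_left, inner_add_right, inner_add_right, hL, hL] at h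
  linarith

theorem eq_zero_of_inner_map_self_eq_zero_of_finrank_le [FiniteDimensional ℝ F] {L : F →ₗ[ℝ] F}
    (hL : ∀ x, inner ℝ (L x) x = 0)
    (hker : Module.finrank ℝ F ≤ Module.finrank ℝ (LinearMap.ker L) + 1) : L = 0 := by
  have hrank : Module.finrank ℝ (LinearMap.range L) ≤ 1 := by
    have := L.finrank_range_add_finrank_ker
    omega
  obtain ⟨a, ha⟩ := finrank_le_one_iff.1 hrank
  have hspan : ∀ x, ∃ c : ℝ, L x = c • (a : F) := fun x =>
    (ha ⟨L x, x, rfl⟩).imp fun c hc => (congrArg Subtype.val hc).symm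
  have hLa : L a = 0 := by
    obtain ⟨c, hc⟩ := hspan a
    have h := hL a
    rw [hc, inner_smul_left, mul_eq_zero, inner_self_eq_zero] at h
    rcases h with h | h
    · rw [hc, show c = 0 from h, zero_smul]
    · rw [h, map_zero]
  ext x
  obtain ⟨c, hc⟩ := hspan x
  rw [LinearMap.zero_apply, ← inner_self_eq_zero (𝕜 := ℝ)]
  nth_rewrite 2 [hc]
  rw [inner_smul_right, inner_map_eq_neg_of_inner_map_self_eq_zero hL, hLa, inner_zero_left,
    neg_zero, mul_zero]

theorem exists_linearMap_of_inner_sub_sub_eq_zero {f : F → F}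
    (hf : ∀ x y, inner ℝ (f x - f y) (x - y) = 0) :
    ∃ L : F →ₗ[ℝ] F, (∀ x, inner ℝ (L x) x = 0) ∧ ∀ x, f x = f 0 + L x := by
  let g : F → F := fun x => f x - f 0
  have hself : ∀ x, inner ℝ (g x) x = 0 := fun x => by simpa using hf x 0
  have hskew : ∀ x y, inner ℝ (g x) y = -inner ℝ (g y) x := fun x y => by
    have h : inner ℝ (g x - g y) (x - y) = 0 := by simpa [g] using hf x y
    rw [inner_sub_left, inner_sub_right, inner_sub_right, hself, hself] at h
    linarith
  -- `⟪g x, z⟫ = -⟪g z, x⟫` is linear in `x`, for every `z`.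
  let L : F →ₗ[ℝ] F :=
    { toFun := g
      map_add' := fun x y => ext_inner_right ℝ fun z => by
        rw [inner_add_left, hskew, hskew x, hskew y, inner_add_right]; ring
      map_smul' := fun c x => ext_inner_right ℝ fun z => by
        rw [RingHom.id_apply, inner_smul_left, hskew, hskew x, inner_smul_right]; simp }
  exact ⟨L, hself, fun x => (add_sub_cancel (f 0) (f x)).symm⟩

theorem inner_sub_sub_eq_zero_of_inner_fderiv_self_eq_zero {f : F → F} (hf : Differentiable ℝ f)
    (hf' : ∀ x h, inner ℝ (fderiv ℝ f x h) h = 0) (x y : F) :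
    inner ℝ (f x - f y) (x - y) = 0 := by
  have hderiv : ∀ t : ℝ, HasDerivAt (fun t : ℝ => inner ℝ (f (y + t • (x - y))) (x - y)) 0 t := by
    intro t
    have hline : HasDerivAt (fun t : ℝ => y + t • (x - y)) (x - y) t := by
      simpa using ((hasDerivAt_id t).smul_const (x - y)).const_add y
    have hcomp := (hf (y + t • (x - y))).hasFDerivAt.comp_hasDerivAt t hline
    have hinner := hcomp.inner ℝ (hasDerivAt_const t (x - y))
    rwa [inner_zero_right, zero_add, hf'] at hinner
  have hconst := is_const_of_deriv_eq_zero (fun t => (hderiv t).differentiableAt)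
    (fun t => (hderiv t).deriv) 1 0
  simp only [one_smul, add_sub_cancel, zero_smul, add_zero] at hconst
  rw [inner_sub_left, hconst, sub_self]

end Skew

theorem transpose_eq_neg_iff_inner_toEuclideanLin_self_eq_zero {ι : Type*} [Fintype ι]
    [DecidableEq ι] {η : Matrix ι ι ℝ} :
    η.transpose = -η ↔ ∀ x, inner ℝ (Matrix.toEuclideanLin η x) x = 0 := by
  set L := Matrix.toEuclideanLin η with hL
  have hadj : Matrix.toEuclideanLin η.transpose = L.adjoint := by
    rw [← Matrix.conjTranspose_eq_transpose_of_trivial,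
      Matrix.toEuclideanLin_conjTranspose_eq_adjoint]
  have hsymm : (L.adjoint + L).IsSymmetric := fun x y => by
    simp only [LinearMap.add_apply, inner_add_left, inner_add_right, LinearMap.adjoint_inner_left,
      LinearMap.adjoint_inner_right, add_comm]
  rw [eq_neg_iff_add_eq_zero, ← Matrix.toEuclideanLin.map_eq_zero_iff, map_add, hadj, ← hL,
    ← hsymm.inner_map_self_eq_zero]
  refine forall_congr' fun x => ?_
  rw [LinearMap.add_apply, inner_add_left, LinearMap.adjoint_inner_left, real_inner_comm,
    add_self_eq_zero]

section RigidMotion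

variable {d : ℕ} {v : C(E d, E d)}

theorem mem_rigidMotion_iff : v ∈ rigidMotion d ↔
    ∃ (a : E d) (L : E d →ₗ[ℝ] E d), (∀ x, inner ℝ (L x) x = 0) ∧ ∀ x, v x = a + L x := by
  constructor
  · rintro ⟨a, η, hη, hv⟩
    exact ⟨a, _, transpose_eq_neg_iff_inner_toEuclideanLin_self_eq_zero.1 hη, hv⟩
  · rintro ⟨a, L, hL, hv⟩
    refine ⟨a, Matrix.toEuclideanLin.symm L,
      transpose_eq_neg_iff_inner_toEuclideanLin_self_eq_zero.2 ?_, ?_⟩ <;>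
    simpa only [LinearEquiv.apply_symm_apply]

theorem eq_zero_of_mem_rigidMotion_of_eqOn_zero (hv : v ∈ rigidMotion d) {s : Set (E d)}
    (hne : s.Nonempty) (hs : d ≤ Module.finrank ℝ (vectorSpan ℝ s) + 1)
    (h : Set.EqOn v 0 s) : v = 0 := by
  obtain ⟨a, L, hL, hv⟩ := mem_rigidMotion_iff.1 hv
  have hker : vectorSpan ℝ s ≤ LinearMap.ker L := by
    rw [vectorSpan, Submodule.span_le]
    rintro _ ⟨x, hx, y, hy, rfl⟩
    have hxy : a + L x = a + L y := by rw [← hv, ← hv, h hx, h hy, Pi.zero_apply, Pi.zero_apply]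
    exact (map_sub L x y).trans (sub_eq_zero.2 (add_left_cancel hxy))
  have hL0 : L = 0 := eq_zero_of_inner_map_self_eq_zero_of_finrank_le hL <| by
    rw [finrank_euclideanSpace_fin]
    exact hs.trans (Nat.add_le_add_right (Submodule.finrank_mono hker) 1)
  obtain ⟨x₀, hx₀⟩ := hne
  have ha : a = 0 := by simpa [hv, hL0] using h hx₀
  ext1 x
  rw [hv, hL0, ha, LinearMap.zero_apply, add_zero, ContinuousMap.zero_apply]

theorem eqOn_zero_of_trace_eq_zero {e : Set (E d)} (h : IsPolytope (d - 1) e)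
    (hv : trace h v = 0) : Set.EqOn v 0 e := by
  intro x hx
  by_contra hne
  have hae : ∀ᵐ y ∂faceMeasure e, v y = 0 :=
    (h.memLp v).coeFn_toLp.symm.trans (Lp.eq_zero_iff_ae_eq_zero.1 hv)
  rw [ae_restrict_iff' h.isCompact.measurableSet] at hae
  have hopen : IsOpen {y | v y ≠ 0} := isOpen_ne_fun v.continuous continuous_const
  refine (h.euclideanHausdorffMeasure_open_inter_pos hopen ⟨x, hne, hx⟩).ne'
    (measure_mono_null ?_ hae)
  exact fun y hy hye => hy.1 (hye hy.2)

theorem injOn_trace_rigidMotion {e : Set (E d)} (h : IsPolytope (d - 1) e) :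
    Set.InjOn (trace h) (rigidMotion d) := by
  intro v hv w hw hvw
  rw [← sub_eq_zero]
  refine eq_zero_of_mem_rigidMotion_of_eqOn_zero (sub_mem hv hw)
    (h.isConnected_interior.nonempty.mono intrinsicInterior_subset)
    (by rw [h.finrank_vectorSpan]; omega)
    (eqOn_zero_of_trace_eq_zero h (by rw [map_sub, hvw, sub_self]))

theorem Qb_trace_eq_of_mem_rigidMotion (k : ℕ) {e : Set (E d)} (h : IsPolytope (d - 1) e)
    (hv : v ∈ rigidMotion d) : Qb k h (trace h v) = trace h v :=
  Submodule.starProjection_eq_self_iff.2 (Submodule.mem_sup_right (Submodule.mem_map_of_mem hv))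

end RigidMotion

section Strain

variable {d r : ℕ} {v : C(E d, E d)}

theorem contDiff_of_mem_polyField (hv : v ∈ polyField d r) : ContDiff ℝ ω v := by
  obtain ⟨p, -, hp⟩ := hv
  rw [contDiff_euclidean]
  intro i
  simp only [hp, contDiff_omega_iff_analyticOnNhd]
  have := AnalyticOnNhd.aeval_mvPolynomial (𝕜 := ℝ) (f := fun x : E d => fun j => x j)
    (s := Set.univ) (fun j => (EuclideanSpace.proj (𝕜 := ℝ) j).analyticOnNhd _) (p i)
  simpa only [MvPolynomial.aeval_eq_eval] using this

theorem contDiff_strain (hv : ContDiff ℝ ω v) (i j : Fin d) :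
    ContDiff ℝ ω fun x => strain v x i j := by
  have hfderiv : ContDiff ℝ ω (fderiv ℝ v) := hv.fderiv_right (by simp)
  have happly : ∀ (a : E d) (l : Fin d), ContDiff ℝ ω fun x => fderiv ℝ v x a l := fun a l =>
    contDiff_euclidean.1 (hfderiv.clm_apply contDiff_const) l
  exact ((happly _ _).add (happly _ _)).div_const 2

theorem inner_fderiv_self_eq_sum_strain (v : C(E d, E d)) (x h : E d) :
    inner ℝ (fderiv ℝ v x h) h = ∑ i, ∑ j, h i * h j * strain v x i j := by
  let D : Fin d → Fin d → ℝ := fun i j => fderiv ℝ v x (EuclideanSpace.single j 1) i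
  have hcoord : ∀ i, fderiv ℝ v x h i = ∑ j, h j * D i j := by
    intro i
    conv_lhs => rw [← (EuclideanSpace.basisFun (Fin d) ℝ).sum_repr h]
    simp [D, map_sum]
  have hsum : inner ℝ (fderiv ℝ v x h) h = ∑ i, ∑ j, h i * h j * D i j := by
    rw [PiLp.inner_apply]
    refine Finset.sum_congr rfl fun i _ => ?_
    simp only [hcoord, RCLike.inner_apply, conj_trivial, Finset.mul_sum, mul_assoc]
  have hswap : ∑ i, ∑ j, h i * h j * D i j = ∑ i, ∑ j, h i * h j * D j i := by
    rw [Finset.sum_comm]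
    simp only [mul_comm (h _) (h _)]
  calc inner ℝ (fderiv ℝ v x h) h
      = ((∑ i, ∑ j, h i * h j * D i j) + ∑ i, ∑ j, h i * h j * D j i) / 2 := by
        rw [← hswap, add_self_div_two, hsum]
    _ = ∑ i, ∑ j, h i * h j * strain v x i j := by
        simp only [← Finset.sum_add_distrib, Finset.sum_div, strain, D]
        exact Finset.sum_congr rfl fun i _ => Finset.sum_congr rfl fun j _ => by ring

theorem mem_rigidMotion_of_strain_eq_zero (hv : Differentiable ℝ v) (h : ∀ x, strain v x = 0) :
    v ∈ rigidMotion d := by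
  obtain ⟨L, hL, hvL⟩ := exists_linearMap_of_inner_sub_sub_eq_zero <|
    inner_sub_sub_eq_zero_of_inner_fderiv_self_eq_zero hv fun x y => by
      simp [inner_fderiv_self_eq_sum_strain, h]
  exact mem_rigidMotion_iff.2 ⟨v 0, L, hL, hvL⟩

theorem mem_rigidMotion_of_strain_eq_zero_on_isOpen (hv : ContDiff ℝ ω v) {U : Set (E d)}
    (hU : IsOpen U) (hne : U.Nonempty) (h : ∀ x ∈ U, strain v x = 0) : v ∈ rigidMotion d := by
  obtain ⟨y, hy⟩ := hne
  refine mem_rigidMotion_of_strain_eq_zero (hv.differentiable (by simp)) fun x => ?_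
  ext i j
  have hanalytic : AnalyticOnNhd ℝ (fun x => strain v x i j) Set.univ :=
    (contDiff_strain hv i j).analyticOnNhd
  exact hanalytic.eqOn_zero_of_preconnected_of_eventuallyEq_zero isPreconnected_univ
    (Set.mem_univ y) (Filter.eventually_of_mem (hU.mem_nhds hy) fun z hz =>
      congrFun₂ (h z hz) i j)
    (Set.mem_univ x)

/-- The strain tensor as a vector whose Euclidean norm is the Frobenius norm of the tensor. -/
def strainVec (v : C(E d, E d)) (x : E d) : EuclideanSpace ℝ (Fin d × Fin d) :=
  WithLp.toLp 2 fun ij => strain v x ij.1 ij.2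

theorem norm_strainVec_sq (v : C(E d, E d)) (x : E d) :
    ‖strainVec v x‖ ^ 2 = ∑ i, ∑ j, strain v x i j ^ 2 := by
  rw [EuclideanSpace.norm_sq_eq, Fintype.sum_prod_type]
  simp [strainVec]

theorem continuous_strainVec (hv : ContDiff ℝ ω v) : Continuous (strainVec v) :=
  (PiLp.continuous_toLp 2 _).comp
    (continuous_pi fun ij => (contDiff_strain hv ij.1 ij.2).continuous)

theorem strainVec_add {w : C(E d, E d)} (hv : Differentiable ℝ v) (hw : Differentiable ℝ w) :
    strainVec (v + w) = strainVec v + strainVec w := by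
  ext x ij
  have hfderiv : fderiv ℝ (v + w : C(E d, E d)) x = fderiv ℝ v x + fderiv ℝ w x :=
    fderiv_add (hv x) (hw x)
  simp only [strainVec, strain, hfderiv, Pi.add_apply, _root_.add_apply, PiLp.add_apply]
  ring

theorem strainVec_const_smul (c : ℝ) (hv : Differentiable ℝ v) :
    strainVec (c • v) = c • strainVec v := by
  ext x ij
  have hfderiv : fderiv ℝ (c • v : C(E d, E d)) x = c • fderiv ℝ v x :=
    fderiv_const_smul (hv x) c
  simp only [strainVec, strain, hfderiv, Pi.smul_apply, _root_.smul_apply, PiLp.smul_apply,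
    smul_eq_mul]
  ring

end Strain

theorem memLp_restrict_of_continuousOn_of_isCompact {X G : Type*} [TopologicalSpace X]
    [MeasurableSpace X] [OpensMeasurableSpace X] [NormedAddCommGroup G] {μ : Measure X}
    [IsFiniteMeasureOnCompacts μ] {K : Set X} (hK : IsCompact K) (hKm : MeasurableSet K)
    {f : X → G} (hf : ContinuousOn f K) (p : ENNReal) : MemLp f p (μ.restrict K) := by
  have : IsFiniteMeasure (μ.restrict K) := ⟨by
    rw [Measure.restrict_apply_univ]
    exact hK.measure_lt_top⟩
  obtain ⟨C, hC⟩ := hK.exists_bound_of_continuousOn hf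
  exact MemLp.of_bound (hf.aestronglyMeasurable_of_isCompact hK hKm) C
    ((ae_restrict_iff' hKm).2 (Filter.Eventually.of_forall hC))

section StrainLp

variable {d r : ℕ} {T : Set (E d)}

theorem memLp_strainVec {v : C(E d, E d)} (hv : ContDiff ℝ ω v) (hT : IsCompact T) :
    MemLp (strainVec v) 2 (volume.restrict T) :=
  memLp_restrict_of_continuousOn_of_isCompact hT hT.measurableSet
    (continuous_strainVec hv).continuousOn 2

/-- The map `v ↦ ε(v)` from the polynomial fields of degree at most `r` to `[L²(T)]^{d × d}`. -/
def strainLp (r : ℕ) (hT : IsCompact T) :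
    polyField d r →ₗ[ℝ] Lp (EuclideanSpace ℝ (Fin d × Fin d)) 2 (volume.restrict T) where
  toFun v := (memLp_strainVec (contDiff_of_mem_polyField v.2) hT).toLp _
  map_add' v w := by
    rw [← MemLp.toLp_add]
    congr 1
    exact strainVec_add ((contDiff_of_mem_polyField v.2).differentiable (by simp))
      ((contDiff_of_mem_polyField w.2).differentiable (by simp))
  map_smul' c v := by
    rw [RingHom.id_apply, ← MemLp.toLp_const_smul]
    congr 1
    exact strainVec_const_smul c ((contDiff_of_mem_polyField v.2).differentiable (by simp))

theorem strainLp_ae_eq (hT : IsCompact T) (v : polyField d r) :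
    strainLp r hT v =ᵐ[volume.restrict T] strainVec v :=
  (memLp_strainVec (contDiff_of_mem_polyField v.2) hT).coeFn_toLp

theorem norm_strainLp_sq (hT : IsCompact T) (v : polyField d r) :
    ‖strainLp r hT v‖ ^ 2 = ∫ x in T, ∑ i, ∑ j, strain v x i j ^ 2 := by
  rw [← real_inner_self_eq_norm_sq, L2.inner_def]
  refine integral_congr_ae ?_
  filter_upwards [strainLp_ae_eq hT v] with x hx
  rw [hx, real_inner_self_eq_norm_sq, norm_strainVec_sq]

theorem mem_rigidMotion_of_strainLp_eq_zero (hT : IsCompact T) (hTi : (interior T).Nonempty)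
    {v : polyField d r} (h : strainLp r hT v = 0) : (v : C(E d, E d)) ∈ rigidMotion d := by
  have hv := contDiff_of_mem_polyField v.2
  have hae : strainVec v =ᵐ[volume.restrict (interior T)] 0 :=
    ae_mono (Measure.restrict_mono interior_subset le_rfl)
      ((strainLp_ae_eq hT v).symm.trans (Lp.eq_zero_iff_ae_eq_zero.1 h))
  have heq : Set.EqOn (strainVec v) 0 (interior T) := Measure.eqOn_open_of_ae_eq hae
    isOpen_interior (continuous_strainVec hv).continuousOn continuousOn_const
  refine mem_rigidMotion_of_strain_eq_zero_on_isOpen hv isOpen_interior hTi fun x hx => ?_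
  ext i j
  exact congrFun (congrArg WithLp.ofLp (heq hx)) (i, j)

end StrainLp

namespace Partition

variable {d : ℕ} {Ω : Set (E d)} (𝒯 : Partition Ω) (k : ℕ)

/-- The jump `Q_b v_0 - v_b` on the face `e`, with `v_0` taken from the element `T`. -/
def jump (T : 𝒯.cells) (e : 𝒯.faces) : 𝒯.WeakFunction →ₗ[ℝ] FaceL2 (e : Set (E d)) where
  toFun v := Qb k (𝒯.isPolytope_face e e.2) (trace (𝒯.isPolytope_face e e.2) (v.1 T)) - v.2 e
  map_add' v w := by
    rw [Prod.fst_add, Prod.snd_add, Pi.add_apply, Pi.add_apply, map_add, map_add]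
    abel
  map_smul' c v := by
    rw [Prod.smul_fst, Prod.smul_snd, Pi.smul_apply, Pi.smul_apply, map_smul, map_smul,
      RingHom.id_apply, smul_sub]

/-- The field `v_0|_T` on the element `T`. -/
def fieldOnCell (T : 𝒯.cells) : 𝒯.Vh k →ₗ[ℝ] polyField d k where
  toFun v := ⟨v.1.1 T, v.2.1 T⟩
  map_add' _ _ := rfl
  map_smul' _ _ := rfl

/-- The values of `energyMap`: a tensor field on each element and a vector field on each pair of an
element and a face, all in `L²`. -/
abbrev EnergySpace : Type :=
  PiLp 2 fun T : 𝒯.cells =>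
    WithLp 2 (Lp (EuclideanSpace ℝ (Fin d × Fin d)) 2 (volume.restrict (T : Set (E d))) ×
      PiLp 2 fun e : 𝒯.faces => FaceL2 (e : Set (E d)))

open scoped Classical in
/-- The map `v ↦ (ε(v_0), h_T^{-1/2} (Q_b v_0 - v_b))_T`, whose norm is the triple norm.  The second
component is `0` on the faces that do not lie on `∂T`. -/
def energyMap : 𝒯.Vh k →ₗ[ℝ] 𝒯.EnergySpace :=
  (WithLp.linearEquiv 2 ℝ _).symm.toLinearMap ∘ₗ LinearMap.pi fun T =>
    (WithLp.linearEquiv 2 ℝ _).symm.toLinearMap ∘ₗ LinearMap.prod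
      (strainLp k (𝒯.isPolytope_cell T T.2).isCompact ∘ₗ 𝒯.fieldOnCell k T)
      ((WithLp.linearEquiv 2 ℝ _).symm.toLinearMap ∘ₗ LinearMap.pi fun e =>
        if (e : Set (E d)) ⊆ frontier (T : Set (E d)) then
          Real.sqrt (Metric.diam (T : Set (E d)))⁻¹ • 𝒯.jump k T e ∘ₗ (𝒯.Vh k).subtype
        else 0)

theorem energyMap_fst (v : 𝒯.Vh k) (T : 𝒯.cells) : (𝒯.energyMap k v T).fst =
    strainLp k (𝒯.isPolytope_cell T T.2).isCompact (𝒯.fieldOnCell k T v) :=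
  rfl

theorem energyMap_snd_of_subset (v : 𝒯.Vh k) {T : 𝒯.cells} {e : 𝒯.faces}
    (h : (e : Set (E d)) ⊆ frontier (T : Set (E d))) : (𝒯.energyMap k v T).snd e =
      Real.sqrt (Metric.diam (T : Set (E d)))⁻¹ • 𝒯.jump k T e v := by
  simp [energyMap, h]

theorem energyMap_snd_of_not_subset (v : 𝒯.Vh k) {T : 𝒯.cells} {e : 𝒯.faces}
    (h : ¬ (e : Set (E d)) ⊆ frontier (T : Set (E d))) : (𝒯.energyMap k v T).snd e = 0 := by
  simp [energyMap, h]

theorem tripleNorm_eq_norm_energyMap (v : 𝒯.Vh k) : 𝒯.tripleNorm k v = ‖𝒯.energyMap k v‖ := by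
  rw [← Real.sqrt_sq (norm_nonneg (𝒯.energyMap k v)), PiLp.norm_sq_eq_of_L2, tripleNorm]
  congr 1
  refine Finset.sum_congr rfl fun T _ => ?_
  rw [WithLp.prod_norm_sq_eq_of_L2, PiLp.norm_sq_eq_of_L2, Finset.mul_sum, energyMap_fst,
    norm_strainLp_sq]
  congr 1
  refine Finset.sum_congr rfl fun e _ => ?_
  split_ifs with h
  · rw [energyMap_snd_of_subset _ _ _ h, norm_smul, mul_pow,
      Real.norm_of_nonneg (Real.sqrt_nonneg _), Real.sq_sqrt (inv_nonneg.2 Metric.diam_nonneg)]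
    rfl
  · rw [energyMap_snd_of_not_subset _ _ _ h, norm_zero, zero_pow two_ne_zero, mul_zero]

variable {𝒯 k}

theorem mem_rigidMotion_and_eq_trace_of_tripleNorm_eq_zero (hd : 1 ≤ d) {v : 𝒯.WeakFunction}
    (hv : v ∈ 𝒯.Vh k) (h : 𝒯.tripleNorm k v = 0) (T : 𝒯.cells) :
    v.1 T ∈ rigidMotion d ∧ ∀ e : 𝒯.faces, (e : Set (E d)) ⊆ frontier (T : Set (E d)) →
      v.2 e = trace (𝒯.isPolytope_face e e.2) (v.1 T) := by
  have hpoly := 𝒯.isPolytope_cell T T.2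
  have henergy : 𝒯.energyMap k ⟨v, hv⟩ = 0 :=
    norm_eq_zero.1 ((𝒯.tripleNorm_eq_norm_energyMap k ⟨v, hv⟩).symm.trans h)
  have hrigid : v.1 T ∈ rigidMotion d := by
    refine mem_rigidMotion_of_strainLp_eq_zero (v := 𝒯.fieldOnCell k T ⟨v, hv⟩) hpoly.isCompact
      hpoly.nonempty_interior ?_
    rw [← energyMap_fst, henergy]
    rfl
  refine ⟨hrigid, fun e he => ?_⟩
  have hscaled : Real.sqrt (Metric.diam (T : Set (E d)))⁻¹ • 𝒯.jump k T e v = 0 := by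
    rw [← 𝒯.energyMap_snd_of_subset k ⟨v, hv⟩ he, henergy]
    rfl
  have hjump : Qb k _ (trace (𝒯.isPolytope_face e e.2) (v.1 T)) - v.2 e = 0 :=
    (smul_eq_zero.1 hscaled).resolve_left
      (Real.sqrt_pos.2 (inv_pos.2 (diam_cell_pos hd T.2))).ne'
  rw [Qb_trace_eq_of_mem_rigidMotion k _ hrigid, sub_eq_zero] at hjump
  exact hjump.symm

theorem eq_zero_of_tripleNorm_eq_zero (hd : 1 ≤ d) {v : 𝒯.WeakFunction} (hv : v ∈ 𝒯.Vh0 k)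
    (h : 𝒯.tripleNorm k v = 0) : v = 0 := by
  have hcell := mem_rigidMotion_and_eq_trace_of_tripleNorm_eq_zero hd hv.1 h
  have hzero : ∀ T (hT : T ∈ 𝒯.cells) e (he : e ∈ 𝒯.faces), e ⊆ frontier T →
      v.2 ⟨e, he⟩ = 0 → v.1 ⟨T, hT⟩ = 0 := fun T hT e he heT hve =>
    injOn_trace_rigidMotion (𝒯.isPolytope_face e he) (hcell ⟨T, hT⟩).1 (zero_mem _) <| by
      rw [← (hcell ⟨T, hT⟩).2 ⟨e, he⟩ heT, hve, map_zero]
  have hcells : ∀ T ∈ 𝒯.cells, ∀ hT : T ∈ 𝒯.cells, v.1 ⟨T, hT⟩ = 0 := by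
    refine forall_cell_of_shared_face_of_boundary_face hd ?_ ?_
    · intro T _ T' hT' e he heT heT' hT'zero hT
      refine hzero T hT e he heT ?_
      rw [(hcell ⟨T', hT'⟩).2 ⟨e, he⟩ heT', hT'zero hT', map_zero]
    · exact fun T _ e he heT heΩ hT => hzero T hT e he heT (hv.2 ⟨e, he⟩ heΩ)
  refine Prod.ext (funext fun T => hcells T T.2 T.2) (funext fun e => ?_)
  obtain ⟨T, hT, heT⟩ := 𝒯.exists_cell e e.2
  rw [(hcell ⟨T, hT⟩).2 e heT, hcells T hT hT, map_zero]
  rfl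

end Partition

end WG

end

theorem mainTheorem8_general (d : ℕ) (hd : 1 ≤ d) (Ω : Set (WG.E d)) (𝒯 : WG.Partition Ω)
    (k : ℕ) :
    (∀ v ∈ 𝒯.Vh k, 0 ≤ 𝒯.tripleNorm k v) ∧
    (∀ v ∈ 𝒯.Vh k, ∀ c : ℝ, 𝒯.tripleNorm k (c • v) = |c| * 𝒯.tripleNorm k v) ∧
    (∀ v ∈ 𝒯.Vh k, ∀ w ∈ 𝒯.Vh k,
      𝒯.tripleNorm k (v + w) ≤ 𝒯.tripleNorm k v + 𝒯.tripleNorm k w) ∧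
    (∀ v ∈ 𝒯.Vh0 k, 𝒯.tripleNorm k v = 0 ↔ v = 0) := by
  have hnorm := 𝒯.tripleNorm_eq_norm_energyMap k
  refine ⟨fun v _ => Real.sqrt_nonneg _, fun v hv c => ?_, fun v hv w hw => ?_,
    fun v hv => ⟨WG.Partition.eq_zero_of_tripleNorm_eq_zero hd hv, ?_⟩⟩
  · have h := norm_smul c (𝒯.energyMap k ⟨v, hv⟩)
    rwa [← map_smul, ← hnorm, ← hnorm] at h
  · have h := norm_add_le (𝒯.energyMap k ⟨v, hv⟩) (𝒯.energyMap k ⟨w, hw⟩)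
    rwa [← map_add, ← hnorm, ← hnorm, ← hnorm] at h
  · rintro rfl
    exact (hnorm 0).trans (by rw [map_zero, norm_zero])

theorem mainTheorem8 (d : ℕ) (hd : d = 2 ∨ d = 3) (Ω : Set (WG.E d)) (hΩo : IsOpen Ω)
    (hΩb : Bornology.IsBounded Ω) (hΩc : IsConnected Ω) (𝒯 : WG.Partition Ω)
    (k : ℕ) (hk : 1 ≤ k) :
    (∀ v ∈ 𝒯.Vh k, 0 ≤ 𝒯.tripleNorm k v) ∧
    (∀ v ∈ 𝒯.Vh k, ∀ c : ℝ, 𝒯.tripleNorm k (c • v) = |c| * 𝒯.tripleNorm k v) ∧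
    (∀ v ∈ 𝒯.Vh k, ∀ w ∈ 𝒯.Vh k,
      𝒯.tripleNorm k (v + w) ≤ 𝒯.tripleNorm k v + 𝒯.tripleNorm k w) ∧
    (∀ v ∈ 𝒯.Vh0 k, 𝒯.tripleNorm k v = 0 ↔ v = 0) :=
  mainTheorem8_general d (by omega) Ω 𝒯 k
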